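/- Let $d\in\mathbb N$, $a>0$, and let $t=\mathrm{ctr}(t)+[-a,a]^d$ and $s=\mathrm{ctr}(s)+[-a,a]^d$ be two cells of the same radius $a$ in $\mathbb R^d$. Let $G:\mathbb R^d\times\mathbb R^d\to\mathbb C$ be a kernel, and let $\tilde G(x,y):=G(\mathrm{ctr}(t)+x,\mathrm{ctr}(s)+y)$, regarded as a function of the $2d$ real variables $z=(x,y)$. Let $\mathcal A$ be a multipole acceptance criterion (a boolean function of pairs of cells, with value $1$ when the two cells are considered well-separated). Suppose that $\mathcal A(t,s)=1$, and that $\mathcal A(t,s)=1$ implies that $\tilde G$ is analytic in its variables at every point of $[-a,a]^{2d}$ with a convergence radius $R>\frac{2a}{e}$ in each variable, i.e. for every $p\in[-a,a]^{2d}$ there is a power series $\sum_{\beta\in\mathbb N^{2d}}c_\beta\,(z-p)^\beta$ that converges in the complex polydisc $\{z\in\mathbb C^{2d}: |z_i-p_i|<R,\ i=1,\dots,2d\}$ and whose sum is $\tilde G(z)$ for every $z\in[-a,a]^{2d}$ in this polydisc. For $L\ge 2$ let $\mathcal I_L^{t\times s}[\tilde G]$ be the tensor-product Lagrange interpolant of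 $\tilde G$ on $[-a,a]^{2d}$ with the $L$ equispaced nodes $x_k=-a+\frac{2ak}{L-1}$, $k=0,\dots,L-1$, in each variable. Then $$\lim_{L\to+\infty}\ \sup_{z\in[-a,a]^{2d}}\big|\mathcal I_L^{t\times s}[\tilde G](z)-\tilde G(z)\big|=0 .$$ Moreover, for every $r$ with $\frac{2a}{e}<r<R$ there is a constant $C>0$, independent of $L$, such that for all $L\ge 2$ $$\sup_{z\in[-a,a]^{2d}}\big|\mathcal I_L^{t\times s}[\tilde G](z)-\tilde G(z)\big|\ \le\ C\,r^{-2d}\,(2^{2d}-1)\Big(\frac{e}{\sqrt2}\Big)^{2d}\Big(\frac{2a}{re}\Big)^{L}.$$ -/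

import Mathlib

open Filter Topology

/-- A cell of the `2^d`-tree: the translate `ctr + [-a, a]^d` of a cube of radius `a > 0`. -/
structure Cell (d : ℕ) where
  ctr : Fin d → ℝ
  radius : ℝ
  radius_pos : 0 < radius

/-- The cube `[-a, a]^ι`. -/
def cube (ι : Type) (a : ℝ) : Set (ι → ℝ) :=
  {z | ∀ i, z i ∈ Set.Icc (-a) a}

/-- The kernel in coordinates relative to the two cell centers,
`G̃(x, y) = G(ctr t + x, ctr s + y)`, as a function of the `2d` variables `z = (x, y)`:
the `Sum.inl` variables are those of `x`, the `Sum.inr` variables those of `y`. -/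
def shiftedKernel {d : ℕ} (G : (Fin d → ℝ) → (Fin d → ℝ) → ℂ) (t s : Cell d) :
    (Fin d ⊕ Fin d → ℝ) → ℂ :=
  fun z => G (fun i => t.ctr i + z (Sum.inl i)) (fun i => s.ctr i + z (Sum.inr i))

/-- `f` is analytic in its variables at every point of the cube `[-a, a]^ι` with convergence
radius (at least) `R` in each variable: around every point `p` of the cube there is a power series
`∑ c_β (z - p)^β`, indexed by multi-indices `β`, which converges in the complex polydisc
`{z | |z_i - p_i| < R for all i}` and whose sum is `f` at the points of the cube in that
polydisc. -/
def AnalyticOnCubeWithRadius {ι : Type} [Fintype ι] (f : (ι → ℝ) → ℂ) (a R : ℝ) : Prop :=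
  ∀ p ∈ cube ι a, ∃ c : (ι → ℕ) → ℂ,
    (∀ w : ι → ℂ, (∀ i, ‖w i‖ < R) → Summable fun β : ι → ℕ => c β * ∏ i, w i ^ β i) ∧
    ∀ z ∈ cube ι a, (∀ i, |z i - p i| < R) →
      HasSum (fun β : ι → ℕ => c β * ∏ i, ((z i - p i : ℝ) : ℂ) ^ β i) (f z)

/-- The `k`-th of the `L` equispaced points of `[-a, a]`, `k = 0, …, L - 1` (for `L ≥ 2`). -/
noncomputable def equispacedNode (a : ℝ) (L : ℕ) (k : Fin L) : ℝ :=
  -a + 2 * a * (k : ℝ) / ((L : ℝ) - 1)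

/-- Tensor-product Lagrange interpolant of `f` on `[-a, a]^ι` with `L` equispaced points in each
variable: `∑_k f(x_k) ∏_i S_{k_i}(z_i)`, with `S_j` the one-dimensional Lagrange basis
polynomials. -/
noncomputable def tensorInterp {ι : Type} [Fintype ι] [DecidableEq ι] (a : ℝ) (L : ℕ)
    (f : (ι → ℝ) → ℂ) (z : ι → ℝ) : ℂ :=
  ∑ k : ι → Fin L, f (fun i => equispacedNode a L (k i)) *
    ((∏ i, (Lagrange.basis Finset.univ (equispacedNode a L) (k i)).eval (z i) : ℝ) : ℂ)

/-! Write `I_i` for interpolation in the `i`-th variable. The `I_i` commute, and expanding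
`∏ I_i = ∏ (1 - (1 - I_i))` writes the error as a signed sum, over the nonempty sets `S` of
variables, of the iterated one-variable remainders `∏_{i ∈ S} (1 - I_i) f`. Such a remainder is at
most `(K / L!)^|S|` times the supremum of the mixed derivative of `f` of order `L` in each variable
of `S`, where `K` bounds the nodal polynomial `∏_k (x - x_k)` on `[-a, a]`. Cauchy estimates bound
the derivative by `M (L! / r^L)^|S|`, uniformly on the compact cube. For equispaced nodes
`K = (L - 1)! (2a / (L - 1))^L`, which by Stirling's inequality is at most `e² (2a / e)^L`. As
`2a / (re) ≤ 1`, the slowest terms are those with `|S| = 1`. -/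

section OneVariable

open Polynomial

variable {a b x : ℝ}

theorem exists_eq_zero_of_strictMono_zeros (n : ℕ) {h : ℕ → ℝ → ℝ}
    (hd : ∀ m, ∀ y ∈ Set.Icc a b, HasDerivWithinAt (h m) (h (m + 1) y) (Set.Icc a b) y)
    {z : Fin (n + 1) → ℝ} (hz : StrictMono z) (hzI : ∀ k, z k ∈ Set.Icc a b)
    (hz0 : ∀ k, h 0 (z k) = 0) : ∃ ξ ∈ Set.Icc a b, h n ξ = 0 := by
  induction n generalizing h with
  | zero => exact ⟨z 0, hzI 0, hz0 0⟩
  | succ n ih =>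
    have rolle (k : Fin (n + 1)) : ∃ ξ ∈ Set.Ioo (z k.castSucc) (z k.succ), h 1 ξ = 0 := by
      have hsub : Set.Icc (z k.castSucc) (z k.succ) ⊆ Set.Icc a b :=
        Set.Icc_subset_Icc (hzI _).1 (hzI _).2
      refine exists_hasDerivAt_eq_zero (hz k.castSucc_lt_succ)
        (fun y hy => ((hd 0 y (hsub hy)).mono hsub).continuousWithinAt) (by rw [hz0, hz0])
        fun y hy => (hd 0 y (hsub (Set.Ioo_subset_Icc_self hy))).hasDerivAt ?_
      exact mem_of_superset (Icc_mem_nhds hy.1 hy.2) hsub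
    choose ξ hξ hξ0 using rolle
    refine ih (fun m => hd (m + 1)) (fun k l hkl => ?_)
      (fun k => ⟨(hzI _).1.trans (hξ k).1.le, (hξ k).2.le.trans (hzI _).2⟩) hξ0
    calc ξ k < z k.succ := (hξ k).2
      _ ≤ z l.castSucc := hz.monotone (Fin.succ_le_castSucc_iff.2 hkl)
      _ < ξ l := (hξ l).1

variable {κ : Type*} {s : Finset κ} {v : κ → ℝ}

theorem iterate_derivative_nodal (s : Finset κ) (v : κ → ℝ) :
    (derivative^[s.card]) (Lagrange.nodal s v) = C (s.card.factorial : ℝ) := by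
  have hdeg : (Lagrange.nodal s v).natDegree = s.card := Lagrange.natDegree_nodal
  have hlead : (Lagrange.nodal s v).coeff s.card = 1 :=
    hdeg ▸ (Lagrange.nodal_monic (s := s) (v := v)).coeff_natDegree
  have hconst : ((derivative^[s.card]) (Lagrange.nodal s v)).natDegree ≤ 0 := by
    simpa [hdeg] using natDegree_iterate_derivative (Lagrange.nodal s v) s.card
  rw [eq_C_of_natDegree_le_zero hconst, coeff_iterate_derivative, zero_add, hlead,
    Nat.descFactorial_self, nsmul_one]

variable [DecidableEq κ]

theorem exists_sub_eval_interpolate_eq (hv : Set.InjOn v s) (hvI : ∀ k ∈ s, v k ∈ Set.Icc a b)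
    {h : ℕ → ℝ → ℝ}
    (hd : ∀ m, ∀ y ∈ Set.Icc a b, HasDerivWithinAt (h m) (h (m + 1) y) (Set.Icc a b) y)
    (hx : x ∈ Set.Icc a b) :
    ∃ ξ ∈ Set.Icc a b, h 0 x - (Lagrange.interpolate s v fun k => h 0 (v k)).eval x =
      h s.card ξ / s.card.factorial * (Lagrange.nodal s v).eval x := by
  set p := Lagrange.interpolate s v fun k => h 0 (v k)
  set ω := Lagrange.nodal s v
  have hp (k) (hk : k ∈ s) : p.eval (v k) = h 0 (v k) := Lagrange.eval_interpolate_at_node _ hv hk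
  have hω (k) (hk : k ∈ s) : ω.eval (v k) = 0 := Lagrange.eval_nodal_at_node hk
  by_cases hxv : x ∈ s.image v
  · obtain ⟨k, hk, rfl⟩ := Finset.mem_image.1 hxv
    exact ⟨v k, hx, by rw [hp k hk, hω k hk, sub_self, mul_zero]⟩
  have hωx : ω.eval x ≠ 0 := Lagrange.eval_nodal_not_at_node fun k hk hxk =>
    hxv (Finset.mem_image.2 ⟨k, hk, hxk.symm⟩)
  -- `q` interpolates `h 0` at the nodes and also at `x`.
  set c := (h 0 x - p.eval x) / ω.eval x with hc
  set q := p + C c * ω with hq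
  have hqd : (derivative^[s.card]) q = C (c * s.card.factorial) := by
    rw [hq, iterate_map_add, iterate_derivative_C_mul, iterate_derivative_nodal,
      iterate_derivative_eq_zero_of_degree_lt (Lagrange.degree_interpolate_lt _ hv), zero_add,
      C_mul]
  let Z : Finset ℝ := insert x (s.image v)
  have hZ : Z.card = s.card + 1 := by
    rw [Finset.card_insert_of_notMem hxv, Finset.card_image_of_injOn hv]
  have hZI : ∀ y ∈ Z, y ∈ Set.Icc a b := by
    simpa [Z] using ⟨hx, hvI⟩
  have hZ0 : ∀ y ∈ Z, h 0 y - q.eval y = 0 := by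
    simp only [Z, Finset.forall_mem_insert, Finset.forall_mem_image, hq, eval_add, eval_mul, eval_C]
    exact ⟨by rw [hc, div_mul_cancel₀ _ hωx]; ring, fun k hk => by rw [hp k hk, hω k hk]; ring⟩
  obtain ⟨ξ, hξ, hξ0⟩ := exists_eq_zero_of_strictMono_zeros s.card
    (h := fun m y => h m y - ((derivative^[m]) q).eval y)
    (fun m y hy => by
      rw [Function.iterate_succ_apply']
      exact (hd m y hy).sub (((derivative^[m]) q).hasDerivWithinAt y _))
    (Z.orderEmbOfFin hZ).strictMono (fun k => hZI _ (Z.orderEmbOfFin_mem hZ k))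
    fun k => hZ0 _ (Z.orderEmbOfFin_mem hZ k)
  refine ⟨ξ, hξ, ?_⟩
  rw [hqd, eval_C, sub_eq_zero] at hξ0
  rw [hξ0, mul_div_cancel_right₀ _ (by positivity), hc, div_mul_cancel₀ _ hωx]

variable {E : Type*} [NormedAddCommGroup E] [NormedSpace ℝ E]

theorem norm_sub_sum_basis_smul_le (hv : Set.InjOn v s) (hvI : ∀ k ∈ s, v k ∈ Set.Icc a b)
    {h : ℕ → ℝ → E}
    (hd : ∀ m, ∀ y ∈ Set.Icc a b, HasDerivWithinAt (h m) (h (m + 1) y) (Set.Icc a b) y)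
    {B : ℝ} (hB : ∀ y ∈ Set.Icc a b, ‖h s.card y‖ ≤ B) (hx : x ∈ Set.Icc a b) :
    ‖h 0 x - ∑ k ∈ s, (Lagrange.basis s v k).eval x • h 0 (v k)‖ ≤
      |(Lagrange.nodal s v).eval x| / s.card.factorial * B := by
  obtain ⟨g, hg, hgE⟩ := exists_dual_vector'' ℝ
    (h 0 x - ∑ k ∈ s, (Lagrange.basis s v k).eval x • h 0 (v k))
  obtain ⟨ξ, hξ, hξe⟩ := exists_sub_eval_interpolate_eq hv hvI (h := fun m y => g (h m y))
    (fun m y hy => g.hasFDerivAt.comp_hasDerivWithinAt y (hd m y hy)) hx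
  have hgB : |g (h s.card ξ)| ≤ B :=
    (g.le_of_opNorm_le hg _).trans ((one_mul _).trans_le (hB ξ hξ))
  have hgerr : g (h 0 x - ∑ k ∈ s, (Lagrange.basis s v k).eval x • h 0 (v k)) =
      g (h 0 x) - (Lagrange.interpolate s v fun k => g (h 0 (v k))).eval x := by
    simp only [map_sub, map_sum, map_smul, smul_eq_mul, Lagrange.interpolate_apply,
      eval_finsetSum, eval_mul, eval_C, mul_comm]
  calc _ = |g (h s.card ξ) / s.card.factorial * (Lagrange.nodal s v).eval x| := by
        rw [← hξe, ← hgerr, hgE]; exact (abs_norm _).symm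
    _ = |(Lagrange.nodal s v).eval x| / s.card.factorial * |g (h s.card ξ)| := by
        rw [abs_mul, abs_div, Nat.abs_cast]; ring
    _ ≤ _ := by gcongr

end OneVariable

section TensorProduct

variable {ι κ E : Type*} [DecidableEq ι] [Fintype κ] [DecidableEq κ] [NormedAddCommGroup E]
  [NormedSpace ℝ E]

/-- Lagrange interpolation at the nodes `v` in the `i`-th variable, the others being frozen. -/
noncomputable def interpAt (v : κ → ℝ) (i : ι) : Module.End ℝ ((ι → ℝ) → E) where
  toFun f z := ∑ k, (Lagrange.basis Finset.univ v k).eval (z i) • f (Function.update z i (v k))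
  map_add' f g := by ext z; simp [Finset.sum_add_distrib]
  map_smul' c f := by ext z; simp [Finset.smul_sum, smul_comm c]

theorem interpAt_apply (v : κ → ℝ) (i : ι) (f : (ι → ℝ) → E) (z : ι → ℝ) :
    interpAt v i f z =
      ∑ k, (Lagrange.basis Finset.univ v k).eval (z i) • f (Function.update z i (v k)) := rfl

theorem commute_interpAt (v : κ → ℝ) (i j : ι) :
    Commute (interpAt (E := E) v i) (interpAt v j) := by
  rcases eq_or_ne i j with rfl | hij
  · exact Commute.refl _
  ext f z
  simp only [Module.End.mul_apply, interpAt_apply, Function.update_of_ne hij,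
    Function.update_of_ne hij.symm, Finset.smul_sum]
  rw [Finset.sum_comm]
  refine Finset.sum_congr rfl fun k _ => Finset.sum_congr rfl fun l _ => ?_
  rw [smul_comm, Function.update_comm hij]

theorem commute_one_sub_interpAt (v : κ → ℝ) (i j : ι) :
    Commute (1 - interpAt (E := E) v i) (1 - interpAt v j) :=
  ((Commute.one_left _).sub_left ((Commute.one_right _).sub_right (commute_interpAt v i j)))

/-- Interpolation at the nodes `v` in each of the variables in `s`. -/
noncomputable def interpOn (v : κ → ℝ) (s : Finset ι) : Module.End ℝ ((ι → ℝ) → E) :=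
  s.noncommProd (interpAt v) fun i _ j _ _ => commute_interpAt v i j

/-- The product over `i ∈ s` of the one-variable interpolation remainders `1 - interpAt v i`. -/
noncomputable def remainderOn (v : κ → ℝ) (s : Finset ι) : Module.End ℝ ((ι → ℝ) → E) :=
  s.noncommProd (fun i => 1 - interpAt v i) fun i _ j _ _ => commute_one_sub_interpAt v i j

theorem interpOn_empty (v : κ → ℝ) : interpOn (ι := ι) (E := E) v ∅ = 1 := rfl

theorem interpOn_insert (v : κ → ℝ) {i : ι} {s : Finset ι} (hi : i ∉ s) :
    interpOn (E := E) v (insert i s) = interpAt v i * interpOn v s :=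
  Finset.noncommProd_insert_of_notMem _ _ _ _ hi

theorem remainderOn_empty (v : κ → ℝ) : remainderOn (ι := ι) (E := E) v ∅ = 1 := rfl

theorem remainderOn_insert (v : κ → ℝ) {i : ι} {s : Finset ι} (hi : i ∉ s) :
    remainderOn (E := E) v (insert i s) = (1 - interpAt v i) * remainderOn v s :=
  Finset.noncommProd_insert_of_notMem _ _ _ _ hi

theorem interpOn_eq_sum_powerset (v : κ → ℝ) (s : Finset ι) :
    interpOn (E := E) v s = ∑ t ∈ s.powerset, (-1 : ℝ) ^ t.card • remainderOn v t := by
  induction s using Finset.induction_on with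
  | empty => simp [interpOn_empty, remainderOn_empty]
  | insert i s hi ih =>
    have hterm : ∀ t ∈ s.powerset,
        (-1 : ℝ) ^ (insert i t).card • remainderOn (E := E) v (insert i t) =
          (interpAt v i - 1) * ((-1 : ℝ) ^ t.card • remainderOn v t) := by
      intro t ht
      have hit : i ∉ t := fun h => hi (Finset.mem_powerset.1 ht h)
      rw [Finset.card_insert_of_notMem hit, remainderOn_insert v hit, pow_succ, mul_smul,
        neg_one_smul, mul_smul_comm, sub_mul, sub_mul, neg_sub]
    rw [interpOn_insert v hi, Finset.sum_powerset_insert hi, Finset.sum_congr rfl hterm,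
      ← Finset.mul_sum, ← ih, sub_mul, one_mul, add_sub_cancel]

theorem norm_interpOn_sub_le (v : κ → ℝ) (s : Finset ι) (f : (ι → ℝ) → E) (z : ι → ℝ) {N : ℝ}
    (hN : ∀ t ⊆ s, t.Nonempty → ‖remainderOn v t f z‖ ≤ N) :
    ‖interpOn v s f z - f z‖ ≤ (2 ^ s.card - 1) * N := by
  have hexpand : interpOn v s f z - f z =
      ∑ t ∈ s.powerset.erase ∅, (-1 : ℝ) ^ t.card • remainderOn v t f z := by
    rw [sub_eq_iff_eq_add', interpOn_eq_sum_powerset, LinearMap.sum_apply, Finset.sum_apply,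
      ← Finset.add_sum_erase _ _ (Finset.empty_mem_powerset s)]
    simp [remainderOn_empty]
  have hcard : ((s.powerset.erase ∅).card : ℝ) = 2 ^ s.card - 1 := by
    rw [Finset.cast_card_erase_of_mem (Finset.empty_mem_powerset s), Finset.card_powerset]
    push_cast; rfl
  rw [hexpand, ← hcard, ← nsmul_eq_mul]
  refine (norm_sum_le _ _).trans (Finset.sum_le_card_nsmul _ _ _ fun t ht => ?_)
  obtain ⟨hne, hts⟩ := Finset.mem_erase.1 ht
  rw [norm_smul, norm_pow, norm_neg, norm_one, one_pow, one_mul]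
  exact hN t (Finset.mem_powerset.1 hts) (Finset.nonempty_iff_ne_empty.2 hne)

/-- The variables outside `s` are carried along by the partition of unity `∑ ℓ_k = 1`. -/
theorem interpOn_apply [Fintype ι] [Nonempty κ] {v : κ → ℝ} (hv : Function.Injective v)
    (s : Finset ι) (f : (ι → ℝ) → E) (z : ι → ℝ) :
    interpOn v s f z = ∑ k : ι → κ,
      (∏ i, (Lagrange.basis Finset.univ v (k i)).eval (z i)) • f (s.piecewise (v ∘ k) z) := by
  induction s using Finset.induction_on generalizing z with
  | empty =>
    have hunity (x : ℝ) : ∑ k, (Lagrange.basis Finset.univ v k).eval x = 1 := by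
      rw [← Polynomial.eval_finsetSum, Lagrange.sum_basis hv.injOn Finset.univ_nonempty,
        Polynomial.eval_one]
    simp only [interpOn_empty, Module.End.one_apply, Finset.piecewise_empty]
    rw [← Finset.sum_smul, ← Fintype.prod_sum fun i k =>
      (Lagrange.basis Finset.univ v k).eval (z i)]
    simp only [hunity, Finset.prod_const_one, one_smul]
  | insert i s hi ih =>
    simp only [interpOn_insert v hi, Module.End.mul_apply, interpAt_apply, ih, Finset.smul_sum]
    rw [Finset.sum_comm]
    refine Finset.sum_congr rfl fun k _ => ?_
    rw [Finset.sum_eq_single (k i)]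
    · have hpoint : s.piecewise (v ∘ k) (Function.update z i (v (k i))) =
          (insert i s).piecewise (v ∘ k) z := by
        rw [Finset.piecewise_insert, Finset.update_piecewise_of_notMem _ _ _ hi]
        rfl
      have hweight : (Lagrange.basis Finset.univ v (k i)).eval (z i) *
          ∏ j, (Lagrange.basis Finset.univ v (k j)).eval (Function.update z i (v (k i)) j) =
          ∏ j, (Lagrange.basis Finset.univ v (k j)).eval (z j) := by
        rw [← Finset.mul_prod_erase _ _ (Finset.mem_univ i),
          ← Finset.mul_prod_erase _ _ (Finset.mem_univ i), Function.update_self,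
          Lagrange.eval_basis_self hv.injOn (Finset.mem_univ _), one_mul]
        congr 1
        refine Finset.prod_congr rfl fun j hj => ?_
        rw [Function.update_of_ne (Finset.ne_of_mem_erase hj)]
      rw [hpoint, smul_smul, hweight]
    · intro m _ hm
      rw [Finset.prod_eq_zero (Finset.mem_univ i), zero_smul, smul_zero]
      rw [Function.update_self, Lagrange.eval_basis_of_ne hm.symm (Finset.mem_univ _)]
    · simp

end TensorProduct

section PartialDerivatives

variable {ι : Type} [DecidableEq ι] {κ E : Type*} [NormedAddCommGroup E] [NormedSpace ℝ E] {a : ℝ}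

theorem update_mem_cube {z : ι → ℝ} (hz : z ∈ cube ι a) (i : ι) {x : ℝ}
    (hx : x ∈ Set.Icc (-a) a) : Function.update z i x ∈ cube ι a := by
  intro j
  rcases eq_or_ne j i with rfl | hji
  · rwa [Function.update_self]
  · rw [Function.update_of_ne hji]
    exact hz j

/-- `F'` is the partial derivative of `F` in the `i`-th variable on the cube `[-a, a]^ι`, one-sided
at the faces. -/
def HasPartialDerivOn (a : ℝ) (i : ι) (F F' : (ι → ℝ) → E) : Prop :=
  ∀ z ∈ cube ι a,
    HasDerivWithinAt (fun t => F (Function.update z i t)) (F' z) (Set.Icc (-a) a) (z i)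

namespace HasPartialDerivOn

variable [Fintype κ] [DecidableEq κ] {v : κ → ℝ} {i j : ι} {F F' : (ι → ℝ) → E}

theorem sub_interpAt (hv : ∀ k, v k ∈ Set.Icc (-a) a) (hij : i ≠ j)
    (hF : HasPartialDerivOn a i F F') :
    HasPartialDerivOn a i (F - interpAt v j F) (F' - interpAt v j F') := by
  intro z hz
  refine (hF z hz).sub ?_
  simp only [interpAt_apply, Function.update_of_ne hij.symm, Function.update_comm hij]
  refine HasDerivWithinAt.fun_sum fun k _ => HasDerivWithinAt.const_smul _ ?_
  simpa only [Function.update_of_ne hij] using hF _ (update_mem_cube hz j (hv k))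

protected theorem remainderOn (hv : ∀ k, v k ∈ Set.Icc (-a) a) {s : Finset ι} (hi : i ∉ s)
    (hF : HasPartialDerivOn a i F F') :
    HasPartialDerivOn a i (remainderOn v s F) (remainderOn v s F') := by
  induction s using Finset.induction_on with
  | empty => exact hF
  | insert j s hj ih =>
    rw [Finset.mem_insert, not_or] at hi
    rw [remainderOn_insert v hj]
    exact (ih hi.2).sub_interpAt hv hi.1

end HasPartialDerivOn

variable [Fintype κ] [DecidableEq κ] {v : κ → ℝ} {K B : ℝ} {z : ι → ℝ}

theorem norm_sub_interpAt_le (hv : Function.Injective v) (hvI : ∀ k, v k ∈ Set.Icc (-a) a)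
    (hK : ∀ x ∈ Set.Icc (-a) a, |(Lagrange.nodal Finset.univ v).eval x| ≤ K) {i : ι}
    {F : ℕ → (ι → ℝ) → E} (hF : ∀ m, HasPartialDerivOn a i (F m) (F (m + 1)))
    (hB : ∀ z ∈ cube ι a, ‖F (Fintype.card κ) z‖ ≤ B) (hz : z ∈ cube ι a) :
    ‖F 0 z - interpAt v i (F 0) z‖ ≤ K / (Fintype.card κ).factorial * B := by
  have hd (m : ℕ) (y : ℝ) (hy : y ∈ Set.Icc (-a) a) :
      HasDerivWithinAt (fun t => F m (Function.update z i t)) (F (m + 1) (Function.update z i y))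
        (Set.Icc (-a) a) y := by
    simpa only [Function.update_idem, Function.update_self] using
      hF m _ (update_mem_cube hz i hy)
  have hB0 : 0 ≤ B := (norm_nonneg _).trans (hB z hz)
  have herr := norm_sub_sum_basis_smul_le hv.injOn (fun k _ => hvI k)
    (h := fun m y => F m (Function.update z i y)) hd
    (fun y hy => hB _ (update_mem_cube hz i hy)) (hz i)
  rw [Function.update_eq_self] at herr
  refine herr.trans ?_
  rw [Finset.card_univ]
  gcongr
  exact hK _ (hz i)

theorem norm_remainderOn_le (hv : Function.Injective v) (hvI : ∀ k, v k ∈ Set.Icc (-a) a)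
    (hK : ∀ x ∈ Set.Icc (-a) a, |(Lagrange.nodal Finset.univ v).eval x| ≤ K)
    {F : (ι → ℕ) → (ι → ℝ) → E}
    (hF : ∀ γ i, HasPartialDerivOn a i (F γ) (F (γ + Pi.single i 1))) (s : Finset ι) (γ : ι → ℕ)
    (hB : ∀ z ∈ cube ι a, ‖F (γ + ∑ i ∈ s, Pi.single i (Fintype.card κ)) z‖ ≤ B)
    (hz : z ∈ cube ι a) :
    ‖remainderOn v s (F γ) z‖ ≤ (K / (Fintype.card κ).factorial) ^ s.card * B := by
  induction s using Finset.induction_on generalizing γ z with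
  | empty => simpa [remainderOn_empty] using hB z hz
  | insert i s hi ih =>
    have hpartial (m : ℕ) : HasPartialDerivOn a i (remainderOn v s (F (γ + Pi.single i m)))
        (remainderOn v s (F (γ + Pi.single i (m + 1)))) := by
      rw [Pi.single_add, ← add_assoc]
      exact (hF _ i).remainderOn hvI hi
    have hB' (y : ι → ℝ) (hy : y ∈ cube ι a) :=
      ih (γ + Pi.single i (Fintype.card κ))
        (by simpa only [Finset.sum_insert hi, add_assoc] using hB) hy
    have hstep := norm_sub_interpAt_le hv hvI hK hpartial hB' hz
    rw [Pi.single_zero, add_zero] at hstep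
    rw [remainderOn_insert v hi, Finset.card_insert_of_notMem hi, pow_succ', mul_assoc]
    exact hstep

end PartialDerivatives

section PowerSeries

variable {ι : Type*} [Fintype ι] {c : (ι → ℕ) → ℂ} {w : ι → ℂ} {R ρ r : ℝ}

/-- The sum at `w` of the multivariate power series with coefficients `c`; the series may be
summable only on a polydisc. -/
noncomputable def powerSeriesSum (c : (ι → ℕ) → ℂ) (w : ι → ℂ) : ℂ :=
  ∑' β : ι → ℕ, c β * ∏ i, w i ^ β i

/-- The multivariate power series with coefficients `c` converges unconditionally at every point of
the open polydisc of radius `R` about the origin. -/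
def ConvergesOnPolydisc (c : (ι → ℕ) → ℂ) (R : ℝ) : Prop :=
  ∀ w : ι → ℂ, (∀ i, ‖w i‖ < R) → Summable fun β : ι → ℕ => c β * ∏ i, w i ^ β i

/-- Coefficients of the partial derivative of order `γ` of the power series with coefficients
`c`. -/
def derivCoeff (γ : ι → ℕ) (c : (ι → ℕ) → ℂ) (β : ι → ℕ) : ℂ :=
  (∏ j, ((β j + γ j).descFactorial (γ j) : ℂ)) * c (β + γ)

theorem derivCoeff_zero (c : (ι → ℕ) → ℂ) : derivCoeff 0 c = c := by
  ext β
  simp [derivCoeff]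

theorem derivCoeff_derivCoeff (γ δ : ι → ℕ) (c : (ι → ℕ) → ℂ) :
    derivCoeff γ (derivCoeff δ c) = derivCoeff (γ + δ) c := by
  ext β
  have hfactor (j : ι) : (β j + γ j).descFactorial (γ j) * (β j + γ j + δ j).descFactorial (δ j) =
      (β j + γ j + δ j).descFactorial (γ j + δ j) := by
    rw [← Nat.descFactorial_mul_descFactorial (Nat.le_add_left (δ j) (γ j)),
      Nat.add_sub_cancel, Nat.add_sub_cancel]
  simp only [derivCoeff, Pi.add_apply, ← add_assoc, ← mul_assoc, ← Finset.prod_mul_distrib,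
    ← Nat.cast_mul, hfactor]

theorem derivCoeff_single [DecidableEq ι] (i : ι) (c : (ι → ℕ) → ℂ) (β : ι → ℕ) :
    derivCoeff (Pi.single i 1) c β = (β i + 1) * c (β + Pi.single i 1) := by
  rw [derivCoeff, Finset.prod_eq_single i]
  · simp
  · intro j _ hj
    simp [Pi.single_eq_of_ne hj]
  · simp

theorem powerSeriesSum_zero (c : (ι → ℕ) → ℂ) : powerSeriesSum c 0 = c 0 := by
  rw [powerSeriesSum, tsum_eq_single 0]
  · simp
  · intro β hβ
    obtain ⟨j, hj⟩ := Function.ne_iff.1 hβ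
    rw [Finset.prod_eq_zero (Finset.mem_univ j) (by simpa using hj), mul_zero]

theorem norm_mul_prod_pow_le (c : (ι → ℕ) → ℂ) (hw : ∀ i, ‖w i‖ ≤ ρ) (β : ι → ℕ) :
    ‖c β * ∏ i, w i ^ β i‖ ≤ ‖c β‖ * ∏ i, ρ ^ β i := by
  rw [norm_mul, norm_prod]
  gcongr with i
  rw [norm_pow]
  exact pow_le_pow_left₀ (norm_nonneg _) (hw i) _

theorem choose_mul_pow_mul_pow_le {x y : ℝ} (hx : 0 ≤ x) (hy : 0 ≤ y) (m n : ℕ) :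
    ((m + n).choose n : ℝ) * (x ^ m * y ^ n) ≤ (x + y) ^ (m + n) := by
  rw [← Nat.choose_symm_add, mul_comm, add_pow]
  simpa only [Nat.add_sub_cancel_left] using Finset.single_le_sum
    (f := fun k => x ^ k * y ^ (m + n - k) * ((m + n).choose k : ℝ))
    (fun k _ => by positivity) (Finset.mem_range.2 (Nat.lt_succ_of_le (Nat.le_add_right m n)))

theorem norm_derivCoeff_mul_prod_pow_le (hρ : 0 ≤ ρ) (hr : 0 < r) (γ : ι → ℕ) (c : (ι → ℕ) → ℂ)
    (β : ι → ℕ) :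
    ‖derivCoeff γ c β‖ * ∏ j, ρ ^ β j ≤
      (∏ j, ((γ j).factorial : ℝ) / r ^ γ j) * (‖c (β + γ)‖ * ∏ j, (ρ + r) ^ (β + γ) j) := by
  have hfactor (j : ι) : ((β j + γ j).descFactorial (γ j) : ℝ) * ρ ^ β j ≤
      (γ j).factorial / r ^ γ j * (ρ + r) ^ (β + γ) j := by
    rw [div_mul_eq_mul_div, le_div_iff₀ (by positivity),
      Nat.descFactorial_eq_factorial_mul_choose, Nat.cast_mul, mul_assoc, mul_assoc]
    gcongr
    exact choose_mul_pow_mul_pow_le hρ hr.le _ _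
  calc ‖derivCoeff γ c β‖ * ∏ j, ρ ^ β j =
      ‖c (β + γ)‖ * ∏ j, ((β j + γ j).descFactorial (γ j) : ℝ) * ρ ^ β j := by
        simp only [derivCoeff, norm_mul, norm_prod, RCLike.norm_natCast, Finset.prod_mul_distrib]
        ring
    _ ≤ ‖c (β + γ)‖ * ∏ j, ((γ j).factorial : ℝ) / r ^ γ j * (ρ + r) ^ (β + γ) j := by
        gcongr ‖c (β + γ)‖ * ?_
        exact Finset.prod_le_prod (fun j _ => by positivity) fun j _ => hfactor j
    _ = _ := by
        rw [Finset.prod_mul_distrib]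
        ring

namespace ConvergesOnPolydisc

theorem summable_norm (hc : ConvergesOnPolydisc c R) (hρ0 : 0 ≤ ρ) (hρ : ρ < R) :
    Summable fun β : ι → ℕ => ‖c β‖ * ∏ i, ρ ^ β i := by
  simpa [abs_of_nonneg hρ0] using
    (hc (fun _ => (ρ : ℂ)) fun _ => by simpa [abs_of_nonneg hρ0] using hρ).norm

theorem norm_powerSeriesSum_derivCoeff_le (hc : ConvergesOnPolydisc c R) (hρ : 0 ≤ ρ) (hr : 0 < r)
    (hρr : ρ + r < R) (hw : ∀ i, ‖w i‖ ≤ ρ) (γ : ι → ℕ) :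
    ‖powerSeriesSum (derivCoeff γ c) w‖ ≤
      (∏ j, ((γ j).factorial : ℝ) / r ^ γ j) * ∑' β, ‖c β‖ * ∏ j, (ρ + r) ^ β j := by
  have hsum := hc.summable_norm (add_nonneg hρ hr.le) hρr
  refine (tsum_of_norm_bounded
    ((hsum.comp_injective (add_left_injective γ)).hasSum.mul_left _) fun β =>
      (norm_mul_prod_pow_le _ hw β).trans
        (norm_derivCoeff_mul_prod_pow_le hρ hr γ c β)).trans ?_
  gcongr _ * ?_
  exact tsum_comp_le_tsum_of_inj hsum (fun β => by positivity) (add_left_injective γ)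

protected theorem derivCoeff (hc : ConvergesOnPolydisc c R) (hR : 0 < R) (γ : ι → ℕ) :
    ConvergesOnPolydisc (derivCoeff γ c) R := by
  intro w hw
  obtain ⟨ρ, hwρ, hρR⟩ := exists_between ((pi_norm_lt_iff hR).2 hw)
  have hsum := (hc.summable_norm ((norm_nonneg w).trans hwρ.le) hρR).comp_injective
    (add_left_injective γ)
  refine Summable.of_norm_bounded (hsum.mul_left (∏ j, ((γ j).factorial : ℝ) / (ρ - ‖w‖) ^ γ j))
    fun β => (norm_mul_prod_pow_le _ (norm_le_pi_norm w) β).trans ?_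
  simpa only [add_sub_cancel, Function.comp_apply] using
    norm_derivCoeff_mul_prod_pow_le (norm_nonneg w) (sub_pos.2 hwρ) γ c β

end ConvergesOnPolydisc

variable [DecidableEq ι]

theorem hasDerivAt_prod_update_pow (w : ι → ℂ) (i : ι) (β : ι → ℕ) (ζ : ℂ) :
    HasDerivAt (fun ζ => ∏ j, Function.update w i ζ j ^ β j)
      (β i * ∏ j, Function.update w i ζ j ^ (β - Pi.single i 1 : ι → ℕ) j) ζ := by
  have hsplit (ζ : ℂ) (α : ι → ℕ) : ∏ j, Function.update w i ζ j ^ α j =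
      ζ ^ α i * ∏ j ∈ Finset.univ.erase i, w j ^ α j := by
    rw [← Finset.mul_prod_erase _ _ (Finset.mem_univ i), Function.update_self]
    congr 1
    refine Finset.prod_congr rfl fun j hj => ?_
    rw [Function.update_of_ne (Finset.ne_of_mem_erase hj)]
  have hrest : ∏ j ∈ Finset.univ.erase i, w j ^ (β - Pi.single i 1 : ι → ℕ) j =
      ∏ j ∈ Finset.univ.erase i, w j ^ β j :=
    Finset.prod_congr rfl fun j hj => by simp [Pi.single_eq_of_ne (Finset.ne_of_mem_erase hj)]
  simp only [hsplit, hrest, ← mul_assoc]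
  rw [Pi.sub_apply, Pi.single_eq_same]
  exact (hasDerivAt_pow (β i) ζ).mul_const _

theorem ConvergesOnPolydisc.hasDerivAt_powerSeriesSum (hc : ConvergesOnPolydisc c R) (hR : 0 < R)
    (hw : ∀ j, ‖w j‖ < R) (i : ι) :
    HasDerivAt (fun ζ => powerSeriesSum c (Function.update w i ζ))
      (powerSeriesSum (derivCoeff (Pi.single i 1) c) w) (w i) := by
  obtain ⟨ρ, hwρ, hρR⟩ := exists_between ((pi_norm_lt_iff hR).2 hw)
  have hsum := hc.summable_norm ((norm_nonneg w).trans hwρ.le) hρR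
  have hterm (β : ι → ℕ) (ζ : ℂ) := (hasDerivAt_prod_update_pow w i β ζ).const_mul (c β)
  have hdiff (β : ι → ℕ) := fun ζ (_ : ζ ∈ Metric.ball (0 : ℂ) ρ) =>
    (hterm β ζ).differentiableAt.differentiableWithinAt (s := Metric.ball (0 : ℂ) ρ)
  have hbound (β : ι → ℕ) (ζ : ℂ) (hζ : ζ ∈ Metric.ball (0 : ℂ) ρ) :
      ‖c β * ∏ j, Function.update w i ζ j ^ β j‖ ≤ ‖c β‖ * ∏ j, ρ ^ β j := by
    refine norm_mul_prod_pow_le c (fun j => ?_) β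
    rcases eq_or_ne j i with rfl | hji
    · rw [Function.update_self]
      exact (mem_ball_zero_iff.1 hζ).le
    · rw [Function.update_of_ne hji]
      exact (norm_le_pi_norm w j).trans hwρ.le
  have hwi : w i ∈ Metric.ball (0 : ℂ) ρ :=
    mem_ball_zero_iff.2 ((norm_le_pi_norm w i).trans_lt hwρ)
  have hderiv := Complex.hasSum_deriv_of_summable_norm hsum hdiff Metric.isOpen_ball hbound hwi
  simp only [(hterm _ _).deriv, Function.update_eq_self] at hderiv
  have hdiffAt := (Complex.differentiableOn_tsum_of_summable_norm hsum hdiff Metric.isOpen_ball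
    hbound).differentiableAt (Metric.isOpen_ball.mem_nhds hwi)
  rw [← (add_left_injective (Pi.single i 1 : ι → ℕ)).hasSum_iff] at hderiv
  · refine hdiffAt.hasDerivAt.congr_deriv (hderiv.tsum_eq.symm.trans (tsum_congr fun β => ?_))
    simp only [Function.comp_apply, derivCoeff_single, add_tsub_cancel_right, Pi.add_apply,
      Pi.single_eq_same, Nat.cast_add, Nat.cast_one]
    ring
  · intro β hβ
    have hβi : β i = 0 := by
      by_contra h0
      refine hβ ⟨β - Pi.single i 1, tsub_add_cancel_of_le ?_⟩
      exact update_le_iff.2 ⟨Nat.one_le_iff_ne_zero.2 h0, fun _ _ => Nat.zero_le _⟩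
    simp [hβi]

end PowerSeries

section TaylorFamily

variable {ι : Type} [Fintype ι] {a R r : ℝ} {c : (ι → ℝ) → (ι → ℕ) → ℂ}

/-- The power series with coefficients `c p`, centred at the points `p` of the cube `[-a, a]^ι`,
converge on the polydiscs of radius `R` and all represent the same function on the cube. That
function is `fun z => c z 0`, since the series centred at `z` takes the value `c z 0` there. -/
structure IsTaylorFamily (a R : ℝ) (c : (ι → ℝ) → (ι → ℕ) → ℂ) : Prop where
  converges : ∀ p ∈ cube ι a, ConvergesOnPolydisc (c p) R
  apply_zero_eq : ∀ p ∈ cube ι a, ∀ z ∈ cube ι a, (∀ i, |z i - p i| < R) →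
    c z 0 = powerSeriesSum (c p) fun i => ((z i - p i : ℝ) : ℂ)

theorem AnalyticOnCubeWithRadius.exists_isTaylorFamily {f : (ι → ℝ) → ℂ}
    (hf : AnalyticOnCubeWithRadius f a R) (hR : 0 < R) :
    ∃ c, IsTaylorFamily a R c ∧ ∀ z ∈ cube ι a, c z 0 = f z := by
  choose! c hc hcf using hf
  have hcz (z : ι → ℝ) (hz : z ∈ cube ι a) : c z 0 = f z := by
    rw [← (hcf z hz z hz fun i => by simpa using hR).tsum_eq, ← powerSeriesSum_zero (c z)]
    simp [powerSeriesSum]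
  exact ⟨c, ⟨hc, fun p hp z hz hzp => (hcz z hz).trans (hcf p hp z hz hzp).tsum_eq.symm⟩, hcz⟩

theorem isCompact_cube (ι : Type) (a : ℝ) : IsCompact (cube ι a) := by
  convert isCompact_univ_pi fun _ : ι => isCompact_Icc (a := -a) (b := a) using 1
  ext z
  simp only [cube, Set.mem_univ_pi, Set.mem_ofPred_eq]

namespace IsTaylorFamily

theorem hasDerivWithinAt [DecidableEq ι] (hc : IsTaylorFamily a R c) (hR : 0 < R) {p z : ι → ℝ}
    (hp : p ∈ cube ι a) (hz : z ∈ cube ι a) (hzp : ∀ j, |z j - p j| < R) (i : ι) :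
    HasDerivWithinAt (fun t => c (Function.update z i t) 0)
      (powerSeriesSum (derivCoeff (Pi.single i 1) (c p)) fun j => ((z j - p j : ℝ) : ℂ))
      (Set.Icc (-a) a) (z i) := by
  set w : ι → ℂ := fun j => ((z j - p j : ℝ) : ℂ) with hw
  have hseries : HasDerivAt (fun t : ℝ => powerSeriesSum (c p) (Function.update w i (t - p i)))
      (powerSeriesSum (derivCoeff (Pi.single i 1) (c p)) w) (z i) := by
    refine HasDerivAt.comp_ofReal (HasDerivAt.comp_sub_const (𝕜 := ℂ)
      (f := fun ζ => powerSeriesSum (c p) (Function.update w i ζ)) _ (p i : ℂ) ?_)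
    rw [← Complex.ofReal_sub]
    exact (hc.converges p hp).hasDerivAt_powerSeriesSum hR
      (fun j => by simpa only [hw, Complex.norm_real, Real.norm_eq_abs] using hzp j) i
  have hnear : ∀ᶠ t in 𝓝[Set.Icc (-a) a] (z i), |t - p i| < R :=
    mem_nhdsWithin_of_mem_nhds (Metric.isOpen_ball.mem_nhds (hzp i : z i ∈ Metric.ball (p i) R))
  refine hseries.hasDerivWithinAt.congr_of_eventuallyEq_of_mem ?_ (hz i)
  filter_upwards [hnear, self_mem_nhdsWithin] with t ht htI
  rw [hc.apply_zero_eq p hp _ (update_mem_cube hz i htI) fun j => ?_]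
  · congr 1
    ext j
    rcases eq_or_ne j i with rfl | hji
    · simp
    · simp [hw, Function.update_of_ne hji]
  · rcases eq_or_ne j i with rfl | hji
    · rwa [Function.update_self]
    · rw [Function.update_of_ne hji]
      exact hzp j

theorem hasPartialDerivOn [DecidableEq ι] (hc : IsTaylorFamily a R c) (hR : 0 < R) (i : ι) :
    HasPartialDerivOn a i (fun z => c z 0) (fun z => derivCoeff (Pi.single i 1) (c z) 0) := by
  intro z hz
  have hd := hc.hasDerivWithinAt hR hz hz (fun j => by simpa using hR) i
  simp only [sub_self, Complex.ofReal_zero] at hd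
  exact hd.congr_deriv (powerSeriesSum_zero _)

/-- The differentiated series at `p` and at `z` both give the one-sided derivative at `z`. -/
theorem derivCoeff_single_one [DecidableEq ι] (hc : IsTaylorFamily a R c) (ha : 0 < a)
    (hR : 0 < R) (i : ι) :
    IsTaylorFamily a R fun z => derivCoeff (Pi.single i 1) (c z) where
  converges p hp := (hc.converges p hp).derivCoeff hR _
  apply_zero_eq _ hp z hz hzp :=
    (uniqueDiffOn_Icc (neg_lt_self ha) _ (hz i)).eq_deriv _ (hc.hasPartialDerivOn hR i z hz)
      (hc.hasDerivWithinAt hR hp hz hzp i)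

protected theorem derivCoeff (hc : IsTaylorFamily a R c) (ha : 0 < a) (hR : 0 < R) (γ : ι → ℕ) :
    IsTaylorFamily a R fun z => derivCoeff γ (c z) := by
  classical
  have hsingle (i : ι) (n : ℕ) {c} (hc : IsTaylorFamily a R c) :
      IsTaylorFamily a R fun z => derivCoeff (Pi.single i n) (c z) := by
    induction n with
    | zero => simpa only [Pi.single_zero, derivCoeff_zero] using hc
    | succ n ih =>
      simpa only [derivCoeff_derivCoeff, ← Pi.single_add, add_comm 1] using
        ih.derivCoeff_single_one ha hR i
  rw [← Finset.univ_sum_single γ]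
  refine Finset.sum_induction _
    (fun δ => ∀ c, IsTaylorFamily a R c → IsTaylorFamily a R fun z => derivCoeff δ (c z))
    (fun δ ε hδ hε c hc => ?_) (fun c hc => ?_) (fun i _ c hc => hsingle i _ hc) c hc
  · simpa only [derivCoeff_derivCoeff] using hδ _ (hε c hc)
  · simpa only [derivCoeff_zero] using hc

theorem exists_norm_derivCoeff_le (hc : IsTaylorFamily a R c) (ha : 0 < a) (hr : 0 < r)
    (hrR : r < R) :
    ∃ M > 0, ∀ z ∈ cube ι a, ∀ γ, ‖derivCoeff γ (c z) 0‖ ≤ M * ∏ j, (γ j).factorial / r ^ γ j := by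
  obtain ⟨ρ, hρ, hρR⟩ : ∃ ρ, 0 < ρ ∧ ρ + r < R :=
    ⟨(R - r) / 2, by linarith, by linarith⟩
  set P : (ι → ℕ) → ℝ := fun γ => ∏ j, (γ j).factorial / r ^ γ j
  have hP (γ) : 0 ≤ P γ := Finset.prod_nonneg fun j _ => by positivity
  let N (p : ι → ℝ) : ℝ := ∑' β, ‖c p β‖ * ∏ j, (ρ + r) ^ β j
  have hN (p) : 0 ≤ N p := tsum_nonneg fun β => by positivity
  have hlocal (p) (hp : p ∈ cube ι a) (z) (hz : z ∈ cube ι a) (hzp : z ∈ Metric.ball p ρ) (γ) :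
      ‖derivCoeff γ (c z) 0‖ ≤ P γ * N p := by
    have hzp' := (dist_pi_lt_iff hρ).1 hzp
    rw [(hc.derivCoeff ha (hr.trans hrR) γ).apply_zero_eq p hp z hz
      fun j => (hzp' j).trans (by linarith)]
    exact (hc.converges p hp).norm_powerSeriesSum_derivCoeff_le hρ.le hr hρR
      (fun j => (Complex.norm_real _).trans_le (hzp' j).le) γ
  obtain ⟨t, ht, hcover⟩ := (isCompact_cube ι a).elim_nhds_subcover (fun p => Metric.ball p ρ)
    fun p _ => Metric.ball_mem_nhds p hρ
  refine ⟨1 + ∑ p ∈ t, N p, by positivity [Finset.sum_nonneg fun p (_ : p ∈ t) => hN p],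
    fun z hz γ => ?_⟩
  obtain ⟨p, hpt, hzp⟩ := Set.mem_iUnion₂.1 (hcover hz)
  calc ‖derivCoeff γ (c z) 0‖ ≤ P γ * N p := hlocal p (ht p hpt) z hz hzp γ
    _ ≤ P γ * ∑ p ∈ t, N p := by
      gcongr
      exact Finset.single_le_sum (fun p _ => hN p) hpt
    _ ≤ (1 + ∑ p ∈ t, N p) * P γ := by linarith [hP γ]

end IsTaylorFamily

end TaylorFamily

section EquispacedNodes

variable {a x : ℝ} {L : ℕ}

theorem equispacedNode_injective (ha : 0 < a) (hL : 2 ≤ L) :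
    Function.Injective (equispacedNode a L) := by
  intro k l hkl
  have hL1 : (0 : ℝ) < L - 1 := sub_pos.2 (by exact_mod_cast hL)
  rw [equispacedNode, equispacedNode, add_right_inj, div_left_inj' hL1.ne',
    mul_right_inj' (by positivity)] at hkl
  exact Fin.ext (by exact_mod_cast hkl)

theorem equispacedNode_mem_Icc (ha : 0 < a) (hL : 2 ≤ L) (k : Fin L) :
    equispacedNode a L k ∈ Set.Icc (-a) a := by
  have hL1 : (0 : ℝ) < L - 1 := sub_pos.2 (by exact_mod_cast hL)
  have hk : (k : ℝ) ≤ L - 1 := le_sub_iff_add_le.2 (by exact_mod_cast k.2)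
  have hnonneg : 0 ≤ 2 * a * (k : ℝ) / (L - 1) := by positivity
  have hle : 2 * a * (k : ℝ) / (L - 1) ≤ 2 * a := by
    rw [div_le_iff₀ hL1]
    gcongr
  constructor <;> rw [equispacedNode] <;> linarith

theorem prod_range_abs_sub_le {m : ℕ} (hm : 1 ≤ m) {y : ℝ} (hy : y ∈ Set.Icc 0 (m : ℝ)) :
    ∏ k ∈ Finset.range (m + 1), |y - k| ≤ m.factorial := by
  induction m, hm using Nat.le_induction generalizing y with
  | base =>
    obtain ⟨hy0, hy1⟩ := hy
    rw [Nat.cast_one] at hy1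
    simp only [Finset.prod_range_succ, Finset.prod_range_zero, one_mul, Nat.cast_zero, sub_zero,
      Nat.cast_one, Nat.factorial_one]
    exact mul_le_one₀ (abs_le.2 ⟨by linarith, hy1⟩) (abs_nonneg _)
      (abs_le.2 ⟨by linarith, by linarith⟩)
  | succ m hm ih =>
    obtain ⟨hy0, hym⟩ := hy
    push_cast at hym
    rw [Nat.factorial_succ, mul_comm, Nat.cast_mul, Nat.cast_succ]
    have hm1 : (1 : ℝ) ≤ m := by exact_mod_cast hm
    rcases le_total y m with hle | hge
    · rw [Finset.prod_range_succ]
      push_cast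
      gcongr
      · exact ih ⟨hy0, hle⟩
      · exact abs_le.2 ⟨by linarith, by linarith⟩
    · rw [Finset.prod_range_succ']
      push_cast
      gcongr
      · simpa only [sub_sub, add_comm (1 : ℝ)] using
          ih (y := y - 1) ⟨by linarith, by linarith⟩
      · exact abs_le.2 ⟨by linarith, by linarith⟩

theorem factorial_le_stirling {m : ℕ} (hm : 1 ≤ m) :
    (m.factorial : ℝ) ≤ Real.exp 1 * √m * (m / Real.exp 1) ^ m := by
  obtain ⟨n, rfl⟩ := Nat.exists_eq_add_of_le' hm
  have hseq : Stirling.stirlingSeq (n + 1) ≤ Real.exp 1 / √2 :=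
    Stirling.stirlingSeq_one ▸ Stirling.stirlingSeq'_antitone n.zero_le
  rw [Stirling.stirlingSeq, div_le_iff₀ (by positivity), Real.sqrt_mul zero_le_two] at hseq
  refine hseq.trans_eq ?_
  field_simp

theorem abs_eval_nodal_equispacedNode_le_factorial (ha : 0 < a) {m : ℕ} (hm : 1 ≤ m)
    (hx : x ∈ Set.Icc (-a) a) :
    |(Lagrange.nodal Finset.univ (equispacedNode a (m + 1))).eval x| ≤
      m.factorial * (2 * a / m) ^ (m + 1) := by
  have hm0 : (0 : ℝ) < m := by exact_mod_cast hm
  set h := 2 * a / m with hh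
  have hh0 : 0 < h := by positivity
  have hnode (k : Fin (m + 1)) : x - equispacedNode a (m + 1) k = h * ((x + a) / h - k) := by
    rw [equispacedNode, Nat.cast_succ, add_sub_cancel_right, mul_sub, mul_div_cancel₀ _ hh0.ne', hh]
    ring
  have hy : (x + a) / h ∈ Set.Icc 0 (m : ℝ) := by
    have hmh : m * h = 2 * a := mul_div_cancel₀ _ hm0.ne'
    refine ⟨div_nonneg (by linarith [hx.1]) hh0.le, ?_⟩
    rw [div_le_iff₀ hh0, hmh]
    linarith [hx.2]
  calc |(Lagrange.nodal Finset.univ (equispacedNode a (m + 1))).eval x|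
    _ = (∏ k ∈ Finset.range (m + 1), |(x + a) / h - k|) * h ^ (m + 1) := by
      simp only [Lagrange.eval_nodal, hnode, Finset.prod_mul_distrib, Finset.prod_const,
        Finset.card_univ, Fintype.card_fin, abs_mul, Finset.abs_prod, abs_pow, abs_of_pos hh0]
      rw [Fin.prod_univ_eq_prod_range (fun k : ℕ => |(x + a) / h - k|), mul_comm]
    _ ≤ m.factorial * h ^ (m + 1) := by
      gcongr
      exact prod_range_abs_sub_le hm hy

theorem abs_eval_nodal_equispacedNode_le (ha : 0 < a) (hL : 2 ≤ L) (hx : x ∈ Set.Icc (-a) a) :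
    |(Lagrange.nodal Finset.univ (equispacedNode a L)).eval x| ≤
      Real.exp 1 ^ 2 * (2 * a / Real.exp 1) ^ L := by
  obtain ⟨m, rfl⟩ := Nat.exists_eq_add_of_le' (one_le_two.trans hL)
  have hm : 1 ≤ m := Nat.succ_le_succ_iff.1 hL
  have hm1 : (1 : ℝ) ≤ m := by exact_mod_cast hm
  calc |(Lagrange.nodal Finset.univ (equispacedNode a (m + 1))).eval x|
    _ ≤ m.factorial * (2 * a / m) ^ (m + 1) := abs_eval_nodal_equispacedNode_le_factorial ha hm hx
    _ ≤ (Real.exp 1 * √m * (m / Real.exp 1) ^ m) * (2 * a / m) ^ (m + 1) := by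
      gcongr
      exact factorial_le_stirling hm
    _ ≤ (Real.exp 1 * m * (m / Real.exp 1) ^ m) * (2 * a / m) ^ (m + 1) := by
      gcongr
      exact Real.sqrt_le_self_iff.2 (Or.inr hm1)
    _ = Real.exp 1 ^ 2 * (2 * a / Real.exp 1) ^ (m + 1) := by
      simp only [div_pow, pow_succ]
      field_simp

end EquispacedNodes

section ErrorBound

variable {ι : Type} [Fintype ι] [DecidableEq ι] {f : (ι → ℝ) → ℂ} {a R r : ℝ} {L : ℕ}

theorem tensorInterp_eq_interpOn {g : (ι → ℝ) → ℂ} (ha : 0 < a) (hL : 2 ≤ L)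
    (hfg : Set.EqOn f g (cube ι a)) (z : ι → ℝ) :
    tensorInterp a L f z = interpOn (equispacedNode a L) Finset.univ g z := by
  have : NeZero L := ⟨by lia⟩
  rw [interpOn_apply (equispacedNode_injective ha hL), tensorInterp]
  refine Finset.sum_congr rfl fun k _ => ?_
  rw [Finset.piecewise_univ, Complex.real_smul, mul_comm,
    hfg fun i => equispacedNode_mem_Icc ha hL (k i)]
  rfl

theorem prod_factorial_div_pow_sum_single (s : Finset ι) (r : ℝ) (L : ℕ) :
    ∏ j, (((∑ i ∈ s, Pi.single i L : ι → ℕ) j).factorial : ℝ) / r ^ (∑ i ∈ s, Pi.single i L) j =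
      (L.factorial / r ^ L) ^ s.card := by
  have hindex (j : ι) : (∑ i ∈ s, Pi.single i L : ι → ℕ) j = if j ∈ s then L else 0 := by
    simp [Finset.sum_apply, Pi.single_apply]
  rw [← Finset.prod_const, ← Finset.prod_subset s.subset_univ fun j _ hj => by simp [hindex, hj]]
  exact Finset.prod_congr rfl fun j hj => by simp [hindex, hj]

theorem IsTaylorFamily.norm_remainderOn_equispacedNode_le {c : (ι → ℝ) → (ι → ℕ) → ℂ}
    (hc : IsTaylorFamily a R c) (ha : 0 < a) (hR : 0 < R) (hr : 0 < r) {M : ℝ}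
    (hM : ∀ z ∈ cube ι a, ∀ γ, ‖derivCoeff γ (c z) 0‖ ≤ M * ∏ j, (γ j).factorial / r ^ γ j)
    (hL : 2 ≤ L) (s : Finset ι) {z : ι → ℝ} (hz : z ∈ cube ι a) :
    ‖remainderOn (equispacedNode a L) s (fun z => c z 0) z‖ ≤
      M * (Real.exp 1 ^ 2 * (2 * a / (r * Real.exp 1)) ^ L) ^ s.card := by
  have hF (γ : ι → ℕ) (i : ι) : HasPartialDerivOn a i (fun z => derivCoeff γ (c z) 0)
      (fun z => derivCoeff (γ + Pi.single i 1) (c z) 0) := by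
    simpa only [derivCoeff_derivCoeff, add_comm (Pi.single i 1)] using
      (hc.derivCoeff ha hR γ).hasPartialDerivOn hR i
  have hbound := norm_remainderOn_le (equispacedNode_injective ha hL)
    (equispacedNode_mem_Icc ha hL) (fun x hx => abs_eval_nodal_equispacedNode_le ha hL hx) hF s 0
    (B := M * (L.factorial / r ^ L) ^ s.card)
    (fun y hy => by
      rw [zero_add, Fintype.card_fin, ← prod_factorial_div_pow_sum_single]
      exact hM y hy _) hz
  simp only [derivCoeff_zero, Fintype.card_fin] at hbound
  refine hbound.trans_eq ?_
  rw [mul_left_comm, ← mul_pow]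
  congr 2
  simp only [div_pow, mul_pow]
  field_simp

theorem AnalyticOnCubeWithRadius.exists_norm_tensorInterp_sub_le
    (hf : AnalyticOnCubeWithRadius f a R) (ha : 0 < a) (hr : 2 * a / Real.exp 1 < r)
    (hrR : r < R) :
    ∃ C > 0, ∀ L : ℕ, 2 ≤ L → ∀ z ∈ cube ι a, ‖tensorInterp a L f z - f z‖ ≤
      (2 ^ Fintype.card ι - 1) * (C * (2 * a / (r * Real.exp 1)) ^ L) := by
  have hr0 : 0 < r := lt_trans (by positivity) hr
  have hR0 : 0 < R := hr0.trans hrR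
  obtain ⟨c, hc, hcf⟩ := hf.exists_isTaylorFamily hR0
  obtain ⟨M, hM0, hM⟩ := hc.exists_norm_derivCoeff_le ha hr0 hrR
  refine ⟨M * (Real.exp 1 ^ 2) ^ Fintype.card ι, by positivity, fun L hL z hz => ?_⟩
  set q := 2 * a / (r * Real.exp 1)
  have hq0 : 0 ≤ q := by positivity
  have hq1 : q ≤ 1 := div_le_one_of_le₀ ((div_le_iff₀ (Real.exp_pos 1)).1 hr.le) (by positivity)
  rw [tensorInterp_eq_interpOn (g := fun z => c z 0) ha hL fun y hy => (hcf y hy).symm,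
    ← hcf z hz]
  refine norm_interpOn_sub_le _ Finset.univ (fun z => c z 0) z fun s _ hs =>
    (hc.norm_remainderOn_equispacedNode_le ha hR0 hr0 hM hL s hz).trans ?_
  rw [mul_pow, mul_assoc]
  gcongr
  · exact one_le_pow₀ (Real.one_le_exp zero_le_one)
  · exact Finset.card_le_univ s
  · exact pow_le_of_le_one (by positivity) (pow_le_one₀ hq0 hq1) hs.card_ne_zero

theorem AnalyticOnCubeWithRadius.tendstoUniformlyOn_tensorInterp
    (hf : AnalyticOnCubeWithRadius f a R) (ha : 0 < a) (hR : 2 * a / Real.exp 1 < R) :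
    TendstoUniformlyOn (fun L => tensorInterp a L f) f atTop (cube ι a) := by
  obtain ⟨r, hr, hrR⟩ := exists_between hR
  have hr0 : 0 < r := lt_trans (by positivity) hr
  obtain ⟨C, -, hC⟩ := hf.exists_norm_tensorInterp_sub_le ha hr hrR
  have hq : 2 * a / (r * Real.exp 1) < 1 := by
    rwa [div_lt_one (by positivity), ← div_lt_iff₀ (Real.exp_pos 1)]
  have hlim := ((tendsto_pow_atTop_nhds_zero_of_lt_one (by positivity) hq).const_mul C).const_mul
    ((2 : ℝ) ^ Fintype.card ι - 1)
  rw [mul_zero, mul_zero] at hlim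
  rw [Metric.tendstoUniformlyOn_iff]
  intro ε hε
  filter_upwards [hlim.eventually_lt_const hε, eventually_ge_atTop 2] with L hLε hL z hz
  rw [dist_comm, dist_eq_norm]
  exact (hC L hL z hz).trans_lt hLε

end ErrorBound

theorem theorem3p1_general {ι : Type} [Fintype ι] [DecidableEq ι] {f : (ι → ℝ) → ℂ} {a R : ℝ}
    (hf : AnalyticOnCubeWithRadius f a R) (ha : 0 < a) (hR : 2 * a / Real.exp 1 < R) :
    TendstoUniformlyOn (fun L => tensorInterp a L f) f atTop (cube ι a) ∧
      ∀ r : ℝ, 2 * a / Real.exp 1 < r → r < R →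
        ∃ C : ℝ, 0 < C ∧ ∀ L : ℕ, 2 ≤ L → ∀ z ∈ cube ι a,
          ‖tensorInterp a L f z - f z‖ ≤
            C * (r ^ Fintype.card ι)⁻¹ * (2 ^ Fintype.card ι - 1) *
              (Real.exp 1 / √2) ^ Fintype.card ι * (2 * a / (r * Real.exp 1)) ^ L := by
  refine ⟨hf.tendstoUniformlyOn_tensorInterp ha hR, fun r hr hrR => ?_⟩
  obtain ⟨C, hC, hbound⟩ := hf.exists_norm_tensorInterp_sub_le ha hr hrR
  have hx : 0 < r ^ Fintype.card ι := pow_pos (lt_trans (by positivity) hr) _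
  have hy : 0 < (Real.exp 1 / √2) ^ Fintype.card ι := by positivity
  refine ⟨C * r ^ Fintype.card ι * ((Real.exp 1 / √2) ^ Fintype.card ι)⁻¹, by positivity,
    fun L hL z hz => (hbound L hL z hz).trans_eq ?_⟩
  generalize r ^ Fintype.card ι = x at *
  generalize (Real.exp 1 / √2) ^ Fintype.card ι = y at *
  field_simp

theorem theorem3p1 {d : ℕ} (G : (Fin d → ℝ) → (Fin d → ℝ) → ℂ)
    (MAC : Cell d → Cell d → Bool) (t s : Cell d) (a R : ℝ)
    (ht : t.radius = a) (hs : s.radius = a)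
    (hR : 2 * a / Real.exp 1 < R)
    (hMAC : MAC t s = true → AnalyticOnCubeWithRadius (shiftedKernel G t s) a R)
    (hts : MAC t s = true) :
    TendstoUniformlyOn (fun L : ℕ => tensorInterp a L (shiftedKernel G t s))
        (shiftedKernel G t s) atTop (cube (Fin d ⊕ Fin d) a) ∧
      ∀ r : ℝ, 2 * a / Real.exp 1 < r → r < R →
        ∃ C : ℝ, 0 < C ∧ ∀ L : ℕ, 2 ≤ L → ∀ z ∈ cube (Fin d ⊕ Fin d) a,
          ‖tensorInterp a L (shiftedKernel G t s) z - shiftedKernel G t s z‖ ≤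
            C * (r ^ (2 * d))⁻¹ * (2 ^ (2 * d) - 1) * (Real.exp 1 / √2) ^ (2 * d) *
              (2 * a / (r * Real.exp 1)) ^ L := by
  simpa only [Fintype.card_sum, Fintype.card_fin, ← two_mul] using
    theorem3p1_general (hMAC hts) (ht ▸ t.radius_pos) hR
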